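/- Let $Z_1, Z_2, \ldots$ be i.i.d. random vectors in $\mathbb{R}^2$ on a probability space, let $S_0 = 0$ and $S_n = Z_1 + \cdots + Z_n$ for $n \ge 1$, and let $L_n$ be the perimeter length of the convex hull of $\{S_0, S_1, \ldots, S_n\}$, where the perimeter length of a line segment is understood to be twice its length (and that of a point to be $0$). Suppose that $\mathbb{E}(\|Z_1\|^2) < \infty$, where $\|\cdot\|$ is the Euclidean norm, and that $\mu := \mathbb{E} Z_1 \neq 0$; write $\hat\mu := \mu / \|\mu\|$. Then, as $n \to \infty$, $$ n^{-1/2} \, \bigl| L_n - 2\, S_n \cdot \hat\mu \bigr| \to 0 \quad \text{in } L^2 . $$ -/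

import Mathlib

open MeasureTheory ProbabilityTheory Filter Topology

/-- The Euclidean plane `ℝ²`. -/
abbrev Plane : Type := EuclideanSpace ℝ (Fin 2)

/-- The determinant of the pair `u, v`; it is nonnegative exactly when `v` points weakly to the
left of the direction `u`. -/
def cross (u v : Plane) : ℝ := u 0 * v 1 - u 1 * v 0

/-- The sides of a convex polygon `K`, oriented counterclockwise: the pairs `(p, q)` of distinct
vertices (extreme points) of `K` such that `K` lies weakly to the left of the line from `p`
to `q`. If `K` has interior points, every side occurs exactly once. If `K` is a segment with distinct
endpoints `p, q`, then both `(p, q)` and `(q, p)` occur (the segment is a polygon with two sides).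
If `K` is a point, there are none. -/
def orientedSides (K : Set Plane) : Set (Plane × Plane) :=
  {e | e.1 ∈ K.extremePoints ℝ ∧ e.2 ∈ K.extremePoints ℝ ∧ e.1 ≠ e.2 ∧
    ∀ x ∈ K, 0 ≤ cross (e.2 - e.1) (x - e.1)}

/-- A polygon has finitely many sides, so that the sum in `perimeter` is a finite one. -/
theorem orientedSides_finite {A : Set Plane} (hA : A.Finite) :
    (orientedSides (convexHull ℝ A)).Finite :=
  (hA.prod hA).subset fun _ he =>
    ⟨extremePoints_convexHull_subset he.1, extremePoints_convexHull_subset he.2.1⟩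

/-- The perimeter length of a convex polygon (the convex hull of a finite set of points): the sum
of the lengths of its sides. The perimeter length of a segment is twice its length. -/
noncomputable def perimeter (K : Set Plane) : ℝ :=
  ∑ᶠ e ∈ orientedSides K, dist e.1 e.2

/-- The random walk with increments `Z 0, Z 1, …`: its `n`-th position is the sum of the first `n`
increments, and it starts at the origin. -/
noncomputable def walk {Ω : Type*} (Z : ℕ → Ω → Plane) (n : ℕ) (ω : Ω) : Plane :=
  ∑ k ∈ Finset.range n, Z k ω

/-- The convex hull of the walk's positions at the times `0, 1, …, n`. -/
def walkHull {Ω : Type*} (Z : ℕ → Ω → Plane) (n : ℕ) (ω : Ω) : Set Plane :=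
  convexHull ℝ ((fun k => walk Z k ω) '' Set.Iic n)

/-- The perimeter length of the convex hull of the walk up to time `n`. -/
noncomputable def hullPerimeter {Ω : Type*} (Z : ℕ → Ω → Plane) (n : ℕ) (ω : Ω) : ℝ :=
  perimeter (walkHull Z n ω)

/-- The unit vector in the direction of `x ≠ 0`. -/
noncomputable def unitVec (x : Plane) : Plane := ‖x‖⁻¹ • x

/-- `Y n → f` in `Lᵖ`: the functions all lie in `Lᵖ`, and the `Lᵖ` norm of `Y n - f` tends
to `0`. -/
def TendstoInLp {Ω : Type*} [MeasurableSpace Ω] (P : Measure Ω) (p : ENNReal)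
    (Y : ℕ → Ω → ℝ) (f : Ω → ℝ) : Prop :=
  MemLp f p P ∧ (∀ n, MemLp (Y n) p P) ∧
    Tendsto (fun n => eLpNorm (Y n - f) p P) atTop (𝓝 0)

/-!
Let `u θ` be the unit vector at angle `θ` from `μ / ‖μ‖`, and let `h` be the support function of the
walk up to time `n`. By Cauchy's formula (`perimeter_convexHull_eq_integral`) the perimeter is the
integral over `θ ∈ [-π/2, π/2]` of the width `h (u θ) + h (-u θ)`, while `2 ⟪Sₙ, μ / ‖μ‖⟫` is the
integral of `⟪Sₙ, u θ⟫`. The difference is therefore the integral of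
`(h (u θ) - ⟪Sₙ, u θ⟫) + h (-u θ)`, two nonnegative terms: how far the walk in the direction `u θ`
exceeds its final value, and how far it falls below its starting point. This walk has drift
`‖μ‖ cos θ`, which is bounded below away from `θ = ±π/2`, so both terms are maxima of a random walk
with negative drift, read backwards or forwards in time (`perimeter_sub_inner_bounds`).

Such maxima are terms of the Lindley recursion `mₙ₊₁ = max 0 (mₙ + ξₙ)`, in which `mₙ` and `ξₙ` are
independent. If the increments have mean at most `0`, then `E mₙ²` grows at most linearly
(`integral_sq_lindley_le`). If in addition they are bounded above and have negative mean, an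
exponential moment of `mₙ`, hence `E mₙ²`, stays bounded (`exists_integral_sq_lindley_le`).
Truncating the increments from above and adding the two bounds gives `E mₙ² ≤ C + ε n` for every
`ε > 0` under a second moment and a negative drift (`exists_integral_sq_lindley_le_add_mul`).
The directions within `δ` of `±π/2` contribute at most a constant times `δ² n` to the second moment
of the difference, and all other directions `o(n)`.

For Cauchy's formula, fix a unit vector `e`. For almost every `t` between the extreme values of
`⟪·, e⟫` on the polygon, exactly one oriented side crosses the line `⟪·, e⟫ = t` upwards
(`exists_orientedSide_crossing`, `orientedSides_crossing_unique`). Integrating over `t`, the lengths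
of the projections of the sides to the direction `e` add up to twice the width, for segments as
well; integrating over `e` turns these lengths into the lengths of the sides.
-/

/-! ### Coordinates in the plane -/

theorem Plane.inner_eq (x y : Plane) : inner ℝ x y = x 0 * y 0 + x 1 * y 1 := by
  simp [PiLp.inner_apply, Fin.sum_univ_two, mul_comm]

theorem Plane.norm_sq_eq (x : Plane) : ‖x‖ ^ 2 = x 0 ^ 2 + x 1 ^ 2 := by
  rw [← real_inner_self_eq_norm_sq, Plane.inner_eq]; ring

theorem Plane.coord_of_norm_one {e : Plane} (he : ‖e‖ = 1) : e 0 ^ 2 + e 1 ^ 2 = 1 := by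
  rw [← Plane.norm_sq_eq, he, one_pow]

/-- In the orthonormal frame given by a unit vector `e`, a vector `x` has the coordinates
`⟪x, e⟫` and `cross e x`. -/
theorem Plane.ext_frame {e x y : Plane} (he : ‖e‖ = 1) (h₁ : inner ℝ x e = inner ℝ y e)
    (h₂ : cross e x = cross e y) : x = y := by
  have h := Plane.coord_of_norm_one he
  simp only [Plane.inner_eq, cross] at h₁ h₂
  ext i
  fin_cases i
  · change x 0 = y 0
    linear_combination e 0 * h₁ - e 1 * h₂ - (x 0 - y 0) * h
  · change x 1 = y 1
    linear_combination e 1 * h₁ + e 0 * h₂ - (x 1 - y 1) * h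

theorem cross_sub_sub_eq_frame {e : Plane} (he : ‖e‖ = 1) (p q x : Plane) :
    cross (q - p) (x - p) = (inner ℝ q e - inner ℝ p e) * (cross e x - cross e p)
      - (cross e q - cross e p) * (inner ℝ x e - inner ℝ p e) := by
  have h := Plane.coord_of_norm_one he
  simp only [Plane.inner_eq, cross, PiLp.sub_apply]
  linear_combination (-((q 0 - p 0) * (x 1 - p 1) - (q 1 - p 1) * (x 0 - p 0))) * h

/-! ### Sides crossed by a line -/

/-- The height, in the frame of the unit vector `e`, at which the line through `p` and `q` meets the
line `⟪·, e⟫ = t`. -/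
noncomputable def chordHeight (e p q : Plane) (t : ℝ) : ℝ :=
  (cross e p * (inner ℝ q e - t) + cross e q * (t - inner ℝ p e)) / (inner ℝ q e - inner ℝ p e)

theorem chordHeight_sub_chordHeight {e : Plane} (he : ‖e‖ = 1) {p q p' q' : Plane} {t : ℝ}
    (h : inner ℝ p e < inner ℝ q e) (h' : inner ℝ p' e < inner ℝ q' e) :
    (chordHeight e p' q' t - chordHeight e p q t) *
        ((inner ℝ q' e - inner ℝ p' e) * (inner ℝ q e - inner ℝ p e)) =
      (inner ℝ q' e - t) * cross (q - p) (p' - p) +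
        (t - inner ℝ p' e) * cross (q - p) (q' - p) := by
  rw [cross_sub_sub_eq_frame he, cross_sub_sub_eq_frame he, chordHeight, chordHeight]
  have h1 : inner ℝ q e - inner ℝ p e ≠ 0 := (sub_pos.2 h).ne'
  have h2 : inner ℝ q' e - inner ℝ p' e ≠ 0 := (sub_pos.2 h').ne'
  field_simp
  ring

/-- Among the chords of a finite set that cross a generic line, one of lowest height supports the
set from below. -/
theorem exists_supporting_chord {e : Plane} (he : ‖e‖ = 1) {V : Set Plane} (hV : V.Finite) {t : ℝ}
    (ht : ∀ x ∈ V, inner ℝ x e ≠ t) (hlo : ∃ p ∈ V, inner ℝ p e < t)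
    (hhi : ∃ q ∈ V, t < inner ℝ q e) :
    ∃ p ∈ V, ∃ q ∈ V, inner ℝ p e < t ∧ t < inner ℝ q e ∧ ∀ x ∈ V, 0 ≤ cross (q - p) (x - p) := by
  obtain ⟨p₀, hp₀, hp₀t⟩ := hlo
  obtain ⟨q₀, hq₀, hq₀t⟩ := hhi
  let C : Set (Plane × Plane) := {c | c ∈ V ×ˢ V ∧ inner ℝ c.1 e < t ∧ t < inner ℝ c.2 e}
  have hC : C.Finite := (hV.prod hV).subset fun c hc => hc.1
  obtain ⟨⟨p, q⟩, ⟨⟨hp, hq⟩, hpt, hqt⟩, hmin⟩ := Set.exists_min_image C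
    (fun c => chordHeight e c.1 c.2 t) hC ⟨(p₀, q₀), ⟨hp₀, hq₀⟩, hp₀t, hq₀t⟩
  refine ⟨p, hp, q, hq, hpt, hqt, fun x hx => ?_⟩
  simp only at hp hq hpt hqt hmin
  have hpq := hpt.trans hqt
  have hself : cross (q - p) (q - p) = 0 := by simp [cross, mul_comm]
  have hzero : cross (q - p) (p - p) = 0 := by simp [cross]
  -- Exchanging one endpoint of the lowest chord for `x` cannot lower it.
  rcases lt_or_gt_of_ne (ht x hx) with hxt | hxt
  · have h := chordHeight_sub_chordHeight he hpq (hxt.trans hqt) (t := t)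
    rw [hself, mul_zero, add_zero] at h
    refine nonneg_of_mul_nonneg_right ?_ (sub_pos.2 hqt)
    rw [← h]
    exact mul_nonneg (sub_nonneg.2 (hmin (x, q) ⟨⟨hx, hq⟩, hxt, hqt⟩))
      (mul_nonneg (sub_nonneg.2 (hxt.trans hqt).le) (sub_nonneg.2 hpq.le))
  · have h := chordHeight_sub_chordHeight he hpq (hpt.trans hxt) (t := t)
    rw [hzero, mul_zero, zero_add] at h
    refine nonneg_of_mul_nonneg_right ?_ (sub_pos.2 hpt)
    rw [← h]
    exact mul_nonneg (sub_nonneg.2 (hmin (p, x) ⟨⟨hp, hx⟩, hpt, hxt⟩))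
      (mul_nonneg (sub_nonneg.2 (hpt.trans hxt).le) (sub_nonneg.2 hpq.le))

theorem mem_openSegment_of_cross_eq_zero {e : Plane} (he : ‖e‖ = 1) {p q x : Plane}
    (hpx : inner ℝ p e < inner ℝ x e) (hxq : inner ℝ x e < inner ℝ q e)
    (h : cross (q - p) (x - p) = 0) : x ∈ openSegment ℝ p q := by
  rw [cross_sub_sub_eq_frame he] at h
  have hd : 0 < inner ℝ q e - inner ℝ p e := by linarith
  refine ⟨(inner ℝ q e - inner ℝ x e) / (inner ℝ q e - inner ℝ p e),
    (inner ℝ x e - inner ℝ p e) / (inner ℝ q e - inner ℝ p e),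
    div_pos (by linarith) hd, div_pos (by linarith) hd, by field_simp; ring, ?_⟩
  apply Plane.ext_frame he
  · rw [inner_add_left, real_inner_smul_left, real_inner_smul_left]
    field_simp
    ring
  · have hlin : ∀ (a b : ℝ), cross e (a • p + b • q) = a * cross e p + b * cross e q := by
      intro a b
      simp only [cross, PiLp.add_apply, PiLp.smul_apply, smul_eq_mul]
      ring
    rw [hlin]
    field_simp
    linear_combination -h

/-- The four endpoints of two upward crossing sides are collinear, and three extreme points never
are. -/
theorem orientedSides_crossing_unique {e : Plane} (he : ‖e‖ = 1) {K : Set Plane} {t : ℝ}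
    {s s' : Plane × Plane} (hs : s ∈ orientedSides K) (hs' : s' ∈ orientedSides K)
    (h₁ : inner ℝ s.1 e < t) (h₂ : t < inner ℝ s.2 e)
    (h₁' : inner ℝ s'.1 e < t) (h₂' : t < inner ℝ s'.2 e) : s = s' := by
  have aux : ∀ {r r' : Plane × Plane}, r ∈ orientedSides K → r' ∈ orientedSides K →
      inner ℝ r.1 e < t → t < inner ℝ r.2 e → inner ℝ r'.1 e < t → t < inner ℝ r'.2 e →
      0 ≤ chordHeight e r'.1 r'.2 t - chordHeight e r.1 r.2 t := by
    intro r r' hr hr' a b a' b'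
    have h := chordHeight_sub_chordHeight he (a.trans b) (a'.trans b') (t := t)
    refine nonneg_of_mul_nonneg_left ?_
      (mul_pos (sub_pos.2 (a'.trans b')) (sub_pos.2 (a.trans b)))
    rw [h]
    exact add_nonneg (mul_nonneg (by linarith) (hr.2.2.2 _ hr'.1.1))
      (mul_nonneg (by linarith) (hr.2.2.2 _ hr'.2.1.1))
  have hzero : ∀ {r r' : Plane × Plane}, r ∈ orientedSides K → r' ∈ orientedSides K →
      inner ℝ r.1 e < t → t < inner ℝ r.2 e → inner ℝ r'.1 e < t → t < inner ℝ r'.2 e →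
      cross (r.2 - r.1) (r'.1 - r.1) = 0 ∧ cross (r.2 - r.1) (r'.2 - r.1) = 0 := by
    intro r r' hr hr' a b a' b'
    have h := chordHeight_sub_chordHeight he (a.trans b) (a'.trans b') (t := t)
    have heq : chordHeight e r'.1 r'.2 t - chordHeight e r.1 r.2 t = 0 := by
      linarith [aux hr hr' a b a' b', aux hr' hr a' b' a b]
    rw [heq, zero_mul] at h
    have n1 := mul_nonneg (sub_pos.2 b').le (hr.2.2.2 _ hr'.1.1)
    have n2 := mul_nonneg (sub_pos.2 a').le (hr.2.2.2 _ hr'.2.1.1)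
    obtain ⟨z1, z2⟩ := (add_eq_zero_iff_of_nonneg n1 n2).1 h.symm
    exact ⟨(mul_eq_zero.1 z1).resolve_left (sub_pos.2 b').ne',
      (mul_eq_zero.1 z2).resolve_left (sub_pos.2 a').ne'⟩
  have hfst : ∀ {r r' : Plane × Plane}, r ∈ orientedSides K → r' ∈ orientedSides K →
      inner ℝ r.1 e < t → t < inner ℝ r.2 e → inner ℝ r'.1 e < t → t < inner ℝ r'.2 e →
      ¬ inner ℝ r.1 e < inner ℝ r'.1 e := by
    intro r r' hr hr' a b a' b' hlt
    have hseg := mem_openSegment_of_cross_eq_zero he hlt (a'.trans b) (hzero hr hr' a b a' b').1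
    have := ((mem_extremePoints.1 hr'.1).2 _ hr.1.1 _ hr.2.1.1 hseg).1
    rw [this] at hlt
    exact lt_irrefl _ hlt
  have hsnd : ∀ {r r' : Plane × Plane}, r ∈ orientedSides K → r' ∈ orientedSides K →
      inner ℝ r.1 e < t → t < inner ℝ r.2 e → inner ℝ r'.1 e < t → t < inner ℝ r'.2 e →
      ¬ inner ℝ r'.2 e < inner ℝ r.2 e := by
    intro r r' hr hr' a b a' b' hlt
    have hseg := mem_openSegment_of_cross_eq_zero he (a.trans b') hlt (hzero hr hr' a b a' b').2
    have := ((mem_extremePoints.1 hr'.2.1).2 _ hr.1.1 _ hr.2.1.1 hseg).2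
    rw [this] at hlt
    exact lt_irrefl _ hlt
  have e1 : inner ℝ s.1 e = inner ℝ s'.1 e :=
    le_antisymm (not_lt.1 (hfst hs' hs h₁' h₂' h₁ h₂)) (not_lt.1 (hfst hs hs' h₁ h₂ h₁' h₂'))
  have e2 : inner ℝ s.2 e = inner ℝ s'.2 e :=
    le_antisymm (not_lt.1 (hsnd hs hs' h₁ h₂ h₁' h₂')) (not_lt.1 (hsnd hs' hs h₁' h₂' h₁ h₂))
  obtain ⟨z1, z2⟩ := hzero hs hs' h₁ h₂ h₁' h₂'
  rw [cross_sub_sub_eq_frame he] at z1 z2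
  have hd : inner ℝ s.2 e - inner ℝ s.1 e ≠ 0 := (sub_pos.2 (h₁.trans h₂)).ne'
  refine Prod.ext (Plane.ext_frame he e1 ?_) (Plane.ext_frame he e2 ?_)
  · rw [e1, sub_self, mul_zero, sub_zero] at z1
    have := (mul_eq_zero.1 z1).resolve_left (by rwa [e1] at hd)
    linarith
  · rw [← e2] at z2
    have := mul_left_cancel₀ hd (show _ * (cross e s.2 - cross e s.1) =
      _ * (cross e s'.2 - cross e s.1) by linarith)
    linarith

theorem convexHull_extremePoints_convexHull {A : Set Plane} (hA : A.Finite) :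
    convexHull ℝ ((convexHull ℝ A).extremePoints ℝ) = convexHull ℝ A := by
  have hfin : ((convexHull ℝ A).extremePoints ℝ).Finite :=
    hA.subset extremePoints_convexHull_subset
  rw [← (hfin.isClosed_convexHull ℝ).closure_eq]
  exact closure_convexHull_extremePoints (hA.isCompact_convexHull ℝ) (convex_convexHull ℝ A)

theorem exists_orientedSide_crossing {e : Plane} (he : ‖e‖ = 1) {A : Set Plane} (hA : A.Finite)
    {t : ℝ} (ht : ∀ x ∈ A, inner ℝ x e ≠ t) (hlo : ∃ p ∈ A, inner ℝ p e < t)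
    (hhi : ∃ q ∈ A, t < inner ℝ q e) :
    ∃ s ∈ orientedSides (convexHull ℝ A), inner ℝ s.1 e < t ∧ t < inner ℝ s.2 e := by
  set V := (convexHull ℝ A).extremePoints ℝ with hV
  have hVA : V ⊆ A := extremePoints_convexHull_subset
  have hVK : convexHull ℝ V = convexHull ℝ A := convexHull_extremePoints_convexHull hA
  have hlin : IsLinearMap ℝ (fun x : Plane => (inner ℝ x e : ℝ)) :=
    ⟨fun x y => inner_add_left x y e, fun c x => real_inner_smul_left x e c⟩
  have hlo' : ∃ p ∈ V, inner ℝ p e < t := by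
    by_contra! h
    obtain ⟨p, hp, hpt⟩ := hlo
    have hp' : p ∈ convexHull ℝ V := hVK ▸ subset_convexHull ℝ A hp
    exact absurd (convexHull_min (t := {x | t ≤ inner ℝ x e}) h
      (convex_halfSpace_ge hlin t) hp') (not_le.2 hpt)
  have hhi' : ∃ p ∈ V, t < inner ℝ p e := by
    by_contra! h
    obtain ⟨p, hp, hpt⟩ := hhi
    have hp' : p ∈ convexHull ℝ V := hVK ▸ subset_convexHull ℝ A hp
    exact absurd (convexHull_min (t := {x | inner ℝ x e ≤ t}) h
      (convex_halfSpace_le hlin t) hp') (not_le.2 hpt)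
  obtain ⟨p, hp, q, hq, hpt, hqt, h⟩ :=
    exists_supporting_chord he (hA.subset hVA) (fun x hx => ht x (hVA hx)) hlo' hhi'
  refine ⟨(p, q), ⟨hp, hq, ?_, ?_⟩, hpt, hqt⟩
  · intro (hpq : p = q)
    rw [hpq] at hpt
    exact lt_asymm hpt hqt
  · rw [← hVK]
    have hcross : ∀ x, cross (q - p) (x - p) = cross (q - p) x - cross (q - p) p := by
      intro x
      simp only [cross, PiLp.sub_apply]
      ring
    have hconv : Convex ℝ {x : Plane | cross (q - p) p ≤ cross (q - p) x} := by
      refine convex_halfSpace_ge ⟨fun x y => ?_, fun c x => ?_⟩ _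
      · simp only [cross, PiLp.add_apply]; ring
      · simp only [cross, PiLp.smul_apply, smul_eq_mul]; ring
    intro x hx
    have : x ∈ {x : Plane | cross (q - p) p ≤ cross (q - p) x} :=
      convexHull_min (fun y hy => by
        have := h y hy
        rw [hcross] at this
        exact sub_nonneg.1 this) hconv hx
    simp only [hcross]
    exact sub_nonneg.2 this

/-! ### Cauchy's perimeter formula -/

theorem integral_indicator_Ioo_one (a b : ℝ) :
    ∫ t, (Set.Ioo a b).indicator (fun _ => (1 : ℝ)) t = max (b - a) 0 := by
  rw [integral_indicator measurableSet_Ioo, setIntegral_const, Real.volume_real_Ioo, smul_eq_mul,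
    mul_one]

/-- Almost every line `⟪·, e⟫ = t` that meets the polygon is crossed upwards by exactly one oriented
side, so the upward extents of the sides add up to the extent of the polygon. -/
theorem sum_orientedSides_posPart {e : Plane} (he : ‖e‖ = 1) {A : Set Plane} (hA : A.Finite)
    {m M : ℝ} (hm : IsLeast ((fun x => inner ℝ x e) '' A) m)
    (hM : IsGreatest ((fun x => inner ℝ x e) '' A) M) :
    ∑ s ∈ (orientedSides_finite hA).toFinset, max (inner ℝ s.2 e - inner ℝ s.1 e) 0 = M - m := by
  classical
  have hmM : m ≤ M := hM.2 hm.1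
  have hint : ∀ a b : ℝ, Integrable ((Set.Ioo a b).indicator (fun _ => (1 : ℝ))) :=
    fun a b => (integrable_indicator_iff measurableSet_Ioo).2 (by simp)
  have key : ∀ᵐ t : ℝ, ∑ s ∈ (orientedSides_finite hA).toFinset,
      (Set.Ioo (inner ℝ s.1 e) (inner ℝ s.2 e)).indicator (fun _ => (1 : ℝ)) t =
        (Set.Ioo m M).indicator (fun _ => (1 : ℝ)) t := by
    filter_upwards [(hA.image (fun x : Plane => (inner ℝ x e : ℝ))).countable.ae_notMem volume]
      with t ht
    by_cases htI : t ∈ Set.Ioo m M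
    · obtain ⟨p, hp, hpm⟩ := hm.1
      obtain ⟨q, hq, hqM⟩ := hM.1
      simp only at hpm hqM
      obtain ⟨s, hs, hs1, hs2⟩ := exists_orientedSide_crossing he hA
        (fun x hx hxt => ht ⟨x, hx, hxt⟩) ⟨p, hp, by rw [hpm]; exact htI.1⟩
        ⟨q, hq, by rw [hqM]; exact htI.2⟩
      rw [Set.indicator_of_mem htI, Finset.sum_eq_single s]
      · exact Set.indicator_of_mem (Set.mem_Ioo.2 ⟨hs1, hs2⟩) _
      · intro s' hs' hne
        refine Set.indicator_of_notMem (fun hmem => hne ?_) _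
        exact orientedSides_crossing_unique he ((orientedSides_finite hA).mem_toFinset.1 hs') hs
          hmem.1 hmem.2 hs1 hs2
      · intro hns
        exact absurd ((orientedSides_finite hA).mem_toFinset.2 hs) hns
    · rw [Set.indicator_of_notMem htI]
      refine Finset.sum_eq_zero fun s hs => Set.indicator_of_notMem (fun hmem => htI ?_) _
      have hs := (orientedSides_finite hA).mem_toFinset.1 hs
      exact ⟨(hm.2 ⟨s.1, extremePoints_convexHull_subset hs.1, rfl⟩).trans_lt hmem.1,
        hmem.2.trans_le (hM.2 ⟨s.2, extremePoints_convexHull_subset hs.2.1, rfl⟩)⟩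
  have h := integral_congr_ae key
  rw [integral_finsetSum _ (fun s _ => hint _ _), integral_indicator_Ioo_one,
    max_eq_left (sub_nonneg.2 hmM)] at h
  rw [← h]
  exact Finset.sum_congr rfl fun s _ => (integral_indicator_Ioo_one _ _).symm

theorem sum_orientedSides_abs {e : Plane} (he : ‖e‖ = 1) {A : Set Plane} (hA : A.Finite)
    {m M : ℝ} (hm : IsLeast ((fun x => inner ℝ x e) '' A) m)
    (hM : IsGreatest ((fun x => inner ℝ x e) '' A) M) :
    ∑ s ∈ (orientedSides_finite hA).toFinset, |inner ℝ (s.2 - s.1) e| = 2 * (M - m) := by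
  have he' : ‖-e‖ = 1 := by rwa [norm_neg]
  have hm' : IsLeast ((fun x => inner ℝ x (-e)) '' A) (-M) := by
    obtain ⟨⟨x, hx, hxM⟩, hub⟩ := hM
    refine ⟨⟨x, hx, by simp only [inner_neg_right]; exact congrArg _ hxM⟩, ?_⟩
    rintro _ ⟨y, hy, rfl⟩
    simp only [inner_neg_right]
    exact neg_le_neg (hub ⟨y, hy, rfl⟩)
  have hM' : IsGreatest ((fun x => inner ℝ x (-e)) '' A) (-m) := by
    obtain ⟨⟨x, hx, hxM⟩, hub⟩ := hm
    refine ⟨⟨x, hx, by simp only [inner_neg_right]; exact congrArg _ hxM⟩, ?_⟩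
    rintro _ ⟨y, hy, rfl⟩
    simp only [inner_neg_right]
    exact neg_le_neg (hub ⟨y, hy, rfl⟩)
  have h := congrArg₂ (· + ·) (sum_orientedSides_posPart he hA hm hM)
    (sum_orientedSides_posPart he' hA hm' hM')
  simp only [← Finset.sum_add_distrib] at h
  calc _ = _ := Finset.sum_congr rfl fun s _ => ?_
    _ = M - m + (-m - -M) := h
    _ = _ := by ring
  rw [inner_sub_left, inner_neg_right, inner_neg_right]
  rcases le_total (inner ℝ s.2 e : ℝ) (inner ℝ s.1 e) with hle | hle
  · rw [abs_of_nonpos (by linarith), max_eq_right (by linarith), max_eq_left (by linarith)]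
    ring
  · rw [abs_of_nonneg (by linarith), max_eq_left (by linarith), max_eq_right (by linarith)]
    ring

/-- The unit vector at angle `θ` from the unit vector `w`. -/
noncomputable def rotatedDir (w : Plane) (θ : ℝ) : Plane :=
  !₂[Real.cos θ * w 0 - Real.sin θ * w 1, Real.cos θ * w 1 + Real.sin θ * w 0]

theorem inner_rotatedDir (x w : Plane) (θ : ℝ) :
    inner ℝ x (rotatedDir w θ) = Real.cos θ * inner ℝ x w + Real.sin θ * cross w x := by
  simp only [Plane.inner_eq, rotatedDir, cross]
  simp
  ring

theorem norm_rotatedDir {w : Plane} (hw : ‖w‖ = 1) (θ : ℝ) : ‖rotatedDir w θ‖ = 1 := by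
  have h := Plane.coord_of_norm_one hw
  have h2 : ‖rotatedDir w θ‖ ^ 2 = 1 := by
    rw [Plane.norm_sq_eq]
    simp only [rotatedDir]
    simp
    linear_combination h + (w 0 ^ 2 + w 1 ^ 2) * Real.sin_sq_add_cos_sq θ
  exact (pow_eq_one_iff_of_nonneg (norm_nonneg _) two_ne_zero).1 h2

theorem continuous_rotatedDir (w : Plane) : Continuous (rotatedDir w) := by
  unfold rotatedDir
  fun_prop

theorem integral_inner_rotatedDir (x w : Plane) :
    ∫ θ in (-(Real.pi / 2))..(Real.pi / 2), inner ℝ x (rotatedDir w θ) = 2 * inner ℝ x w := by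
  simp only [inner_rotatedDir]
  rw [intervalIntegral.integral_add
      (Continuous.intervalIntegrable (by fun_prop) _ _)
      (Continuous.intervalIntegrable (by fun_prop) _ _),
    intervalIntegral.integral_mul_const, intervalIntegral.integral_mul_const, integral_cos,
    integral_sin]
  simp only [Real.sin_neg, Real.cos_neg, Real.sin_pi_div_two]
  ring

theorem integral_abs_cos_sub (ψ : ℝ) :
    ∫ θ in (-(Real.pi / 2))..(Real.pi / 2), |Real.cos (θ - ψ)| = 2 := by
  have hper : Function.Periodic (fun θ => |Real.cos (θ - ψ)|) Real.pi := fun θ => by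
    simp only
    rw [show θ + Real.pi - ψ = θ - ψ + Real.pi by ring, Real.cos_add_pi, abs_neg]
  have h := hper.intervalIntegral_add_eq (-(Real.pi / 2)) (ψ - Real.pi / 2)
  rw [show -(Real.pi / 2) + Real.pi = Real.pi / 2 by ring] at h
  rw [h, intervalIntegral.integral_comp_sub_right (fun θ => |Real.cos θ|) ψ,
    show ψ - Real.pi / 2 - ψ = -(Real.pi / 2) by ring,
    show ψ - Real.pi / 2 + Real.pi - ψ = Real.pi / 2 by ring]
  have hcongr : ∫ θ in (-(Real.pi / 2))..(Real.pi / 2), |Real.cos θ| =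
      ∫ θ in (-(Real.pi / 2))..(Real.pi / 2), Real.cos θ := by
    refine intervalIntegral.integral_congr fun θ hθ => ?_
    rw [Set.uIcc_of_le (by linarith [Real.pi_pos])] at hθ
    exact abs_of_nonneg (Real.cos_nonneg_of_mem_Icc hθ)
  rw [hcongr, integral_cos]
  simp
  norm_num

theorem integral_abs_inner_rotatedDir (x : Plane) {w : Plane} (hw : ‖w‖ = 1) :
    ∫ θ in (-(Real.pi / 2))..(Real.pi / 2), |inner ℝ x (rotatedDir w θ)| = 2 * ‖x‖ := by
  have hw' := Plane.coord_of_norm_one hw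
  -- In the frame of `w`, the vector `x` has length `‖x‖` and angle `ψ`.
  set ζ : ℂ := ⟨inner ℝ x w, cross w x⟩ with hζ
  have hnorm : ‖ζ‖ = ‖x‖ := by
    have h2 : ‖ζ‖ ^ 2 = ‖x‖ ^ 2 := by
      rw [Complex.sq_norm, Complex.normSq_apply, Plane.norm_sq_eq, hζ]
      simp only [Plane.inner_eq, cross]
      linear_combination (x 0 ^ 2 + x 1 ^ 2) * hw'
    exact (pow_left_inj₀ (norm_nonneg _) (norm_nonneg _) two_ne_zero).1 h2
  have h1 : inner ℝ x w = ‖x‖ * Real.cos ζ.arg := by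
    rw [← hnorm, Complex.norm_mul_cos_arg]
  have h2 : cross w x = ‖x‖ * Real.sin ζ.arg := by
    rw [← hnorm, Complex.norm_mul_sin_arg]
  have : ∀ θ, |inner ℝ x (rotatedDir w θ)| = ‖x‖ * |Real.cos (θ - ζ.arg)| := by
    intro θ
    have hcos : inner ℝ x (rotatedDir w θ) = ‖x‖ * Real.cos (θ - ζ.arg) := by
      rw [inner_rotatedDir, h1, h2, Real.cos_sub]
      ring
    rw [hcos, abs_mul, abs_norm]
  simp only [this]
  rw [intervalIntegral.integral_const_mul, integral_abs_cos_sub, mul_comm]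

/-- The support function of the points `x 0, …, x n` in the direction `u`. -/
noncomputable def supportFn (x : ℕ → Plane) (n : ℕ) (u : Plane) : ℝ :=
  (Finset.range (n + 1)).sup' Finset.nonempty_range_add_one fun k => inner ℝ (x k) u

theorem continuous_supportFn (n : ℕ) :
    Continuous fun p : (ℕ → Plane) × Plane => supportFn p.1 n p.2 := by
  refine Continuous.finset_sup'_apply _ fun k _ => ?_
  fun_prop

/-- Cauchy's formula: the perimeter is the integral of the width over all directions. -/
theorem perimeter_convexHull_eq_integral (x : ℕ → Plane) (n : ℕ) {w : Plane} (hw : ‖w‖ = 1) :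
    perimeter (convexHull ℝ (x '' Set.Iic n)) =
      ∫ θ in (-(Real.pi / 2))..(Real.pi / 2),
        (supportFn x n (rotatedDir w θ) + supportFn x n (-rotatedDir w θ)) := by
  have hA : (x '' Set.Iic n).Finite := (Set.finite_Iic n).image x
  have hmax : ∀ u : Plane, IsGreatest ((fun y => inner ℝ y u) '' (x '' Set.Iic n))
      (supportFn x n u) := by
    intro u
    obtain ⟨k, hk, hkeq⟩ := Finset.exists_mem_eq_sup' (Finset.nonempty_range_add_one (n := n))
      fun k => (inner ℝ (x k) u : ℝ)
    refine ⟨⟨x k, ⟨k, Nat.lt_succ_iff.1 (Finset.mem_range.1 hk), rfl⟩, hkeq.symm⟩, ?_⟩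
    rintro _ ⟨_, ⟨j, hj, rfl⟩, rfl⟩
    exact Finset.le_sup' (fun k => (inner ℝ (x k) u : ℝ))
      (Finset.mem_range.2 (Nat.lt_succ_iff.2 hj))
  have hmin : ∀ u : Plane, IsLeast ((fun y => inner ℝ y u) '' (x '' Set.Iic n))
      (-supportFn x n (-u)) := by
    intro u
    obtain ⟨⟨y, hy, hyeq⟩, hub⟩ := hmax (-u)
    refine ⟨⟨y, hy, ?_⟩, ?_⟩
    · simp only [← hyeq, inner_neg_right, neg_neg]
    · rintro _ ⟨z, hz, rfl⟩
      have := hub ⟨z, hz, rfl⟩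
      simp only [inner_neg_right] at this ⊢
      linarith
  rw [perimeter, finsum_mem_eq_finite_toFinset_sum _ (orientedSides_finite hA)]
  have hlen : ∀ s : Plane × Plane, dist s.1 s.2 =
      ∫ θ in (-(Real.pi / 2))..(Real.pi / 2), |inner ℝ (s.2 - s.1) (rotatedDir w θ)| / 2 := by
    intro s
    rw [intervalIntegral.integral_div, integral_abs_inner_rotatedDir _ hw, dist_comm,
      dist_eq_norm]
    ring
  simp only [hlen]
  have hcont := continuous_rotatedDir w
  rw [← intervalIntegral.integral_finsetSum (fun s _ => by
    apply Continuous.intervalIntegrable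
    fun_prop)]
  congr 1
  ext θ
  rw [← Finset.sum_div, sum_orientedSides_abs (norm_rotatedDir hw θ) hA (hmin _) (hmax _)]
  ring

/-! ### The Lindley recursion -/

/-- The Lindley recursion `mₙ₊₁ = max 0 (mₙ + xₙ)` started from `0`. Its `n`-th term is the largest
sum `x k + ⋯ + x (n - 1)` over `k ≤ n`, the empty sum included. -/
noncomputable def lindley (x : ℕ → ℝ) : ℕ → ℝ
  | 0 => 0
  | n + 1 => max 0 (lindley x n + x n)

theorem lindley_nonneg (x : ℕ → ℝ) : ∀ n, 0 ≤ lindley x n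
  | 0 => le_rfl
  | _ + 1 => le_max_left _ _

theorem sum_Ico_le_lindley (x : ℕ → ℝ) {k n : ℕ} (h : k ≤ n) :
    ∑ j ∈ Finset.Ico k n, x j ≤ lindley x n := by
  induction n, h using Nat.le_induction with
  | base => simpa using lindley_nonneg x k
  | succ n hn ih =>
    rw [Finset.sum_Ico_succ_top hn]
    exact (add_le_add_left ih _).trans (le_max_right _ _)

theorem lindley_add_le (x y : ℕ → ℝ) : ∀ n, lindley (x + y) n ≤ lindley x n + lindley y n
  | 0 => by simp [lindley]
  | n + 1 => by
    have ih := lindley_add_le x y n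
    refine max_le (add_nonneg (lindley_nonneg x _) (lindley_nonneg y _)) ?_
    have hx : lindley x n + x n ≤ lindley x (n + 1) := le_max_right _ _
    have hy : lindley y n + y n ≤ lindley y (n + 1) := le_max_right _ _
    rw [Pi.add_apply]
    linarith

theorem lindley_congr {x y : ℕ → ℝ} : ∀ {n : ℕ}, (∀ j < n, x j = y j) → lindley x n = lindley y n
  | 0, _ => rfl
  | n + 1, h => by
    rw [lindley, lindley, h n n.lt_succ_self,
      lindley_congr fun j hj => h j (hj.trans n.lt_succ_self)]

theorem lindley_le_mul {x : ℕ → ℝ} {K : ℝ} (hK : 0 ≤ K) (hx : ∀ j, x j ≤ K) :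
    ∀ n : ℕ, lindley x n ≤ n * K
  | 0 => by simp [lindley]
  | n + 1 => by
    have ih := lindley_le_mul hK hx n
    have := hx n
    refine max_le (by positivity) ?_
    push_cast
    linarith

theorem measurable_lindley : ∀ n : ℕ, Measurable fun x : ℕ → ℝ => lindley x n
  | 0 => measurable_const
  | n + 1 => measurable_const.max ((measurable_lindley n).add (measurable_pi_apply n))

section Probability

variable {Ω : Type*} [MeasurableSpace Ω] {P : Measure Ω}

theorem indepFun_lindley {ξ : ℕ → Ω → ℝ} (hind : iIndepFun ξ P) (hξ : ∀ k, AEMeasurable (ξ k) P)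
    (n : ℕ) : IndepFun (fun ω => lindley (fun k => ξ k ω) n) (ξ n) P := by
  classical
  have h := hind.indepFun_finset₀ (Finset.range n) {n} (by simp) hξ
  let φ : (Finset.range n → ℝ) → ℝ :=
    fun t => lindley (fun j => if h : j ∈ Finset.range n then t ⟨j, h⟩ else 0) n
  have hφ : Measurable φ := by
    refine (measurable_lindley n).comp (measurable_pi_lambda _ fun j => ?_)
    by_cases hj : j ∈ Finset.range n
    · simp only [hj, dif_pos]
      exact measurable_pi_apply _
    · simp only [hj, dif_neg, not_false_eq_true]
      exact measurable_const
  have h2 := h.comp hφ (measurable_pi_apply (⟨n, Finset.mem_singleton_self n⟩ : ({n} : Finset ℕ)))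
  refine h2.congr (ae_of_all _ fun ω => lindley_congr fun j hj => ?_) (ae_of_all _ fun ω => rfl)
  simp [hj]

theorem memLp_lindley [IsProbabilityMeasure P] {ξ : ℕ → Ω → ℝ}
    (hL : ∀ k, MemLp (ξ k) 2 P) (n : ℕ) : MemLp (fun ω => lindley (fun k => ξ k ω) n) 2 P := by
  induction n with
  | zero => exact MemLp.zero
  | succ n ih => exact (MemLp.zero (ε := ℝ)).sup (ih.add (hL n))

/-- With increments of nonpositive mean, each step adds at most one increment's second moment to
the second moment of the Lindley recursion. -/
theorem integral_sq_lindley_le [IsProbabilityMeasure P] {ξ : ℕ → Ω → ℝ} (hind : iIndepFun ξ P)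
    (hL : ∀ k, MemLp (ξ k) 2 P) (hmean : ∀ k, ∫ ω, ξ k ω ∂P ≤ 0) {s : ℝ}
    (hs : ∀ k, ∫ ω, ξ k ω ^ 2 ∂P ≤ s) (n : ℕ) :
    ∫ ω, lindley (fun k => ξ k ω) n ^ 2 ∂P ≤ n * s := by
  induction n with
  | zero => simp [lindley]
  | succ n ih =>
    have hm := memLp_lindley hL n
    have hi := indepFun_lindley hind (fun k => (hL k).aemeasurable) n
    have hI2 : Integrable (fun ω => lindley (fun k => ξ k ω) n ^ 2) P := hm.integrable_sq
    have hI3 : Integrable (fun ω => 2 * (lindley (fun k => ξ k ω) n * ξ n ω)) P :=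
      (hm.integrable_mul (hL n)).const_mul 2
    have hI4 : Integrable (fun ω => ξ n ω ^ 2) P := (hL n).integrable_sq
    have hI23 : Integrable (fun ω => lindley (fun k => ξ k ω) n ^ 2 +
        2 * (lindley (fun k => ξ k ω) n * ξ n ω)) P := hI2.add hI3
    have hle : ∫ ω, lindley (fun k => ξ k ω) (n + 1) ^ 2 ∂P ≤
        ∫ ω, (lindley (fun k => ξ k ω) n ^ 2 + 2 * (lindley (fun k => ξ k ω) n * ξ n ω) +
          ξ n ω ^ 2) ∂P := by
      refine integral_mono (memLp_lindley hL (n + 1)).integrable_sq (hI23.add hI4)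
        fun ω => ?_
      simp only [lindley]
      rcases max_cases 0 (lindley (fun k => ξ k ω) n + ξ n ω) with ⟨h, -⟩ | ⟨h, -⟩ <;> rw [h] <;>
        nlinarith [sq_nonneg (lindley (fun k => ξ k ω) n + ξ n ω)]
    rw [integral_add hI23 hI4, integral_add hI2 hI3, integral_const_mul,
      hi.integral_fun_mul_eq_mul_integral hm.1 (hL n).1] at hle
    have hneg : (∫ ω, lindley (fun k => ξ k ω) n ∂P) * ∫ ω, ξ n ω ∂P ≤ 0 :=
      mul_nonpos_of_nonneg_of_nonpos (integral_nonneg fun ω => lindley_nonneg _ n) (hmean n)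
    have := hs n
    push_cast
    linarith

/-- For increments bounded above with mean at most `-c`, a small exponential moment contracts by a
factor `1 - lc / 2` at each step, so the Lindley recursion is bounded in `L²`. -/
theorem exists_integral_sq_lindley_le [IsProbabilityMeasure P] {K c s : ℝ} (hK : 0 ≤ K)
    (hc : 0 < c) (hs0 : 0 ≤ s) : ∃ C : ℝ, ∀ ξ : ℕ → Ω → ℝ, iIndepFun ξ P →
      (∀ k, MemLp (ξ k) 2 P) → (∀ k ω, ξ k ω ≤ K) → (∀ k, ∫ ω, ξ k ω ∂P ≤ -c) →
      (∀ k, ∫ ω, ξ k ω ^ 2 ∂P ≤ s) → ∀ n, ∫ ω, lindley (fun k => ξ k ω) n ^ 2 ∂P ≤ C := by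
  -- `l * K ≤ 1` allows `exp y ≤ 1 + y + y ^ 2` at `y = l * ξ`; `l * s ≤ c / 2` makes the quadratic
  -- term at most half of the linear one.
  obtain ⟨l, hl0, hlK, hls⟩ : ∃ l : ℝ, 0 < l ∧ l * K ≤ 1 ∧ l * s ≤ c / 2 := by
    refine ⟨min (1 / (K + 1)) (c / 2 / (s + 1)), by positivity, ?_, ?_⟩
    · calc _ ≤ 1 / (K + 1) * K := mul_le_mul_of_nonneg_right (min_le_left _ _) hK
        _ ≤ 1 := by rw [one_div_mul_eq_div, div_le_one (by positivity)]; linarith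
    · calc _ ≤ c / 2 / (s + 1) * s := mul_le_mul_of_nonneg_right (min_le_right _ _) hs0
        _ ≤ c / 2 := by
          rw [div_mul_eq_mul_div, div_le_iff₀ (by positivity)]
          nlinarith
  refine ⟨2 / l ^ 2 * (2 / (l * c)), fun ξ hind hL hub hmean hs n => ?_⟩
  have hbdd : ∀ n, Integrable (fun ω => Real.exp (l * lindley (fun k => ξ k ω) n)) P := by
    intro n
    refine Integrable.of_bound (C := Real.exp (l * (n * K)))
      (Real.measurable_exp.comp_aemeasurable
        ((memLp_lindley hL n).aemeasurable.const_mul l)).aestronglyMeasurable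
      (ae_of_all _ fun ω => ?_)
    rw [Real.norm_eq_abs, Real.abs_exp, Real.exp_le_exp]
    exact mul_le_mul_of_nonneg_left (lindley_le_mul hK (fun j => hub j ω) n) hl0.le
  have hexpξ : ∀ k, Integrable (fun ω => Real.exp (l * ξ k ω)) P := by
    intro k
    refine Integrable.of_bound (C := Real.exp (l * K))
      (Real.measurable_exp.comp_aemeasurable
        ((hL k).aemeasurable.const_mul l)).aestronglyMeasurable (ae_of_all _ fun ω => ?_)
    rw [Real.norm_eq_abs, Real.abs_exp, Real.exp_le_exp]
    exact mul_le_mul_of_nonneg_left (hub k ω) hl0.le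
  have hquad : ∀ y : ℝ, y ≤ 1 → Real.exp y ≤ 1 + y + y ^ 2 := by
    intro y hy
    rcases le_total (-1) y with h | h
    · have := (abs_le.1 (Real.abs_exp_sub_one_sub_id_le (abs_le.2 ⟨h, hy⟩))).2
      linarith
    · have : Real.exp y ≤ 1 := Real.exp_le_one_iff.2 (by linarith)
      nlinarith
  have hmgf : ∀ k, ∫ ω, Real.exp (l * ξ k ω) ∂P ≤ 1 - l * c / 2 := by
    intro k
    have hI1 : Integrable (fun ω => 1 + l * ξ k ω) P :=
      (integrable_const _).add (((hL k).integrable one_le_two).const_mul l)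
    have hI2 : Integrable (fun ω => l ^ 2 * ξ k ω ^ 2) P := (hL k).integrable_sq.const_mul _
    calc ∫ ω, Real.exp (l * ξ k ω) ∂P ≤ ∫ ω, (1 + l * ξ k ω + l ^ 2 * ξ k ω ^ 2) ∂P := by
          refine integral_mono (hexpξ k) (hI1.add hI2) fun ω => ?_
          have := hquad (l * ξ k ω)
            ((mul_le_mul_of_nonneg_left (hub k ω) hl0.le).trans hlK)
          simp only
          linarith [mul_pow l (ξ k ω) 2]
      _ = 1 + l * ∫ ω, ξ k ω ∂P + l ^ 2 * ∫ ω, ξ k ω ^ 2 ∂P := by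
          rw [integral_add hI1 hI2, integral_add (integrable_const _)
            (((hL k).integrable one_le_two).const_mul l), integral_const_mul, integral_const_mul]
          simp
      _ ≤ 1 + l * (-c) + l * (c / 2) := by
          have h1 := mul_le_mul_of_nonneg_left (hmean k) hl0.le
          have h2 := mul_le_mul_of_nonneg_left (hs k) (sq_nonneg l)
          have h3 := mul_le_mul_of_nonneg_left hls hl0.le
          nlinarith
      _ = _ := by ring
  have hexp : ∀ n, ∫ ω, Real.exp (l * lindley (fun k => ξ k ω) n) ∂P ≤ 2 / (l * c) := by
    intro n
    induction n with
    | zero =>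
      -- The contraction factor is positive, which gives `l * c < 2`.
      have h1 := hmgf 0
      have h2 : 0 ≤ ∫ ω, Real.exp (l * ξ 0 ω) ∂P := integral_nonneg fun ω => (Real.exp_pos _).le
      simp only [lindley, mul_zero, Real.exp_zero, integral_const, probReal_univ, smul_eq_mul,
        mul_one]
      rw [le_div_iff₀ (by positivity)]
      linarith
    | succ n ih =>
      have hi := (indepFun_lindley hind (fun k => (hL k).aemeasurable) n).comp
        (φ := fun y : ℝ => Real.exp (l * y)) (ψ := fun y : ℝ => Real.exp (l * y))
        (by fun_prop) (by fun_prop)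
      have hprod : Integrable (fun ω => Real.exp (l * lindley (fun k => ξ k ω) n) *
          Real.exp (l * ξ n ω)) P := hi.integrable_mul (hbdd n) (hexpξ n)
      have heq : ∫ ω, Real.exp (l * lindley (fun k => ξ k ω) n) * Real.exp (l * ξ n ω) ∂P =
          (∫ ω, Real.exp (l * lindley (fun k => ξ k ω) n) ∂P) * ∫ ω, Real.exp (l * ξ n ω) ∂P :=
        hi.integral_fun_mul_eq_mul_integral (hbdd n).1 (hexpξ n).1
      calc ∫ ω, Real.exp (l * lindley (fun k => ξ k ω) (n + 1)) ∂P
          ≤ ∫ ω, (1 + Real.exp (l * lindley (fun k => ξ k ω) n) * Real.exp (l * ξ n ω)) ∂P := by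
            refine integral_mono (hbdd _) ((integrable_const _).add hprod) fun ω => ?_
            simp only [lindley]
            rw [← Real.exp_add, ← mul_add]
            rcases max_cases 0 (lindley (fun k => ξ k ω) n + ξ n ω) with ⟨h, -⟩ | ⟨h, -⟩ <;>
              rw [h]
            · rw [mul_zero, Real.exp_zero]
              linarith [Real.exp_pos (l * (lindley (fun k => ξ k ω) n + ξ n ω))]
            · linarith
        _ = 1 + (∫ ω, Real.exp (l * lindley (fun k => ξ k ω) n) ∂P) *
              ∫ ω, Real.exp (l * ξ n ω) ∂P := by
            rw [integral_add (integrable_const _) hprod, heq]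
            simp
        _ ≤ 1 + 2 / (l * c) * (1 - l * c / 2) := by
            have h2 : 0 ≤ ∫ ω, Real.exp (l * ξ n ω) ∂P :=
              integral_nonneg fun ω => (Real.exp_pos _).le
            have := mul_le_mul ih (hmgf n) h2 (by positivity)
            linarith
        _ = 2 / (l * c) := by field_simp; ring
  calc ∫ ω, lindley (fun k => ξ k ω) n ^ 2 ∂P
      ≤ ∫ ω, 2 / l ^ 2 * Real.exp (l * lindley (fun k => ξ k ω) n) ∂P := by
        refine integral_mono (memLp_lindley hL n).integrable_sq ((hbdd n).const_mul _) fun ω => ?_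
        have := Real.quadratic_le_exp_of_nonneg
          (mul_nonneg hl0.le (lindley_nonneg (fun k => ξ k ω) n))
        simp only
        rw [div_mul_eq_mul_div, le_div_iff₀ (by positivity)]
        nlinarith [mul_nonneg hl0.le (lindley_nonneg (fun k => ξ k ω) n)]
    _ ≤ 2 / l ^ 2 * (2 / (l * c)) := by
        rw [integral_const_mul]
        exact mul_le_mul_of_nonneg_left (hexp n) (by positivity)

theorem exists_integral_sq_tail_le {X : Ω → ℝ} (hX : MemLp X 2 P) {ε : ℝ} (hε : 0 < ε) :
    ∃ K : ℝ, 0 ≤ K ∧ ∫ ω, max (X ω - K) 0 ^ 2 ∂P ≤ ε := by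
  have h : Tendsto (fun K : ℕ => ∫ ω, max (X ω - K) 0 ^ 2 ∂P) atTop (𝓝 (∫ _, (0 : ℝ) ∂P)) := by
    refine tendsto_integral_of_dominated_convergence (fun ω => X ω ^ 2) (fun K => ?_)
      hX.integrable_sq (fun K => ae_of_all _ fun ω => ?_) (ae_of_all _ fun ω => ?_)
    · exact
        (((hX.aemeasurable.sub_const _).max aemeasurable_const).pow_const 2).aestronglyMeasurable
    · rw [Real.norm_eq_abs, abs_of_nonneg (sq_nonneg _)]
      have hK : (0 : ℝ) ≤ K := K.cast_nonneg
      rcases max_cases (X ω - K) 0 with ⟨h, h'⟩ | ⟨h, -⟩ <;> rw [h] <;> nlinarith [sq_nonneg (X ω)]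
    · refine tendsto_const_nhds.congr' ?_
      filter_upwards [eventually_ge_atTop ⌈X ω⌉₊] with K hK
      have : X ω ≤ K := (Nat.le_ceil _).trans (Nat.cast_le.2 hK)
      rw [max_eq_right (by linarith)]
      simp
  rw [integral_zero] at h
  obtain ⟨K, hK⟩ := ((h.eventually_lt_const hε).exists)
  exact ⟨K, K.cast_nonneg, hK.le⟩

/-- A negative drift makes the second moment of the Lindley recursion `o(n)`, uniformly over all
i.i.d. sequences with the given law: split the increments into a part bounded above, with the whole
drift, and a centred part of small variance. -/
theorem exists_integral_sq_lindley_le_add_mul [IsProbabilityMeasure P] {X : Ω → ℝ}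
    (hX : MemLp X 2 P) (hmean : ∫ ω, X ω ∂P < 0) {ε : ℝ} (hε : 0 < ε) :
    ∃ C : ℝ, ∀ ξ : ℕ → Ω → ℝ, iIndepFun ξ P → (∀ k, IdentDistrib (ξ k) X P P) →
      ∀ n : ℕ, ∫ ω, lindley (fun k => ξ k ω) n ^ 2 ∂P ≤ C + ε * n := by
  obtain ⟨K, hK, htail⟩ := exists_integral_sq_tail_le hX (half_pos hε)
  have hY : MemLp (fun ω => max (X ω - K) 0) 2 P :=
    (hX.sub (memLp_const K)).sup (MemLp.zero (ε := ℝ))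
  set τ := ∫ ω, max (X ω - K) 0 ∂P with hτ
  have hτ0 : 0 ≤ τ := integral_nonneg fun ω => le_max_right _ _
  let g : ℝ → ℝ := fun x => max (x - K) 0 - τ
  let f : ℝ → ℝ := fun x => x - g x
  have hg : Measurable g := by fun_prop
  have hf : Measurable f := by fun_prop
  have hgX : MemLp (g ∘ X) 2 P := hY.sub (memLp_const τ)
  have hfX : MemLp (f ∘ X) 2 P := hX.sub hgX
  have hgmean : ∫ ω, (g ∘ X) ω ∂P = 0 := by
    change ∫ ω, (max (X ω - K) 0 - τ) ∂P = 0
    rw [integral_sub (hY.integrable one_le_two) (integrable_const _), integral_const]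
    simp [hτ]
  have hfmean : ∫ ω, (f ∘ X) ω ∂P = ∫ ω, X ω ∂P := by
    change ∫ ω, (X ω - (g ∘ X) ω) ∂P = _
    rw [integral_sub (hX.integrable one_le_two) (hgX.integrable one_le_two), hgmean, sub_zero]
  have hgsq : ∫ ω, (g ∘ X) ω ^ 2 ∂P ≤ ε / 2 := by
    refine le_trans (le_of_eq ?_) ((sub_le_self _ (sq_nonneg τ)).trans htail)
    have : ∀ ω, (g ∘ X) ω ^ 2 = max (X ω - K) 0 ^ 2 - 2 * τ * max (X ω - K) 0 + τ ^ 2 := by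
      intro ω
      simp only [g, Function.comp]
      ring
    simp only [this]
    have hI : Integrable (fun ω => 2 * τ * max (X ω - K) 0) P :=
      (hY.integrable one_le_two).const_mul _
    have hI' : Integrable (fun ω => max (X ω - K) 0 ^ 2 - 2 * τ * max (X ω - K) 0) P :=
      hY.integrable_sq.sub hI
    rw [integral_add hI' (integrable_const _), integral_sub hY.integrable_sq hI,
      integral_const_mul, ← hτ]
    simp
    ring
  obtain ⟨C, hC⟩ := exists_integral_sq_lindley_le (P := P) (K := K + τ) (add_nonneg hK hτ0)
    (neg_pos.2 hmean) (integral_nonneg (μ := P) fun ω => sq_nonneg ((f ∘ X) ω))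
  refine ⟨2 * C, fun ξ hind hid n => ?_⟩
  have hidf : ∀ k, IdentDistrib (f ∘ ξ k) (f ∘ X) P P := fun k => (hid k).comp hf
  have hidg : ∀ k, IdentDistrib (g ∘ ξ k) (g ∘ X) P P := fun k => (hid k).comp hg
  have hsq : Measurable fun x : ℝ => x ^ 2 := by fun_prop
  have hfL : ∀ k, MemLp (f ∘ ξ k) 2 P := fun k => (hidf k).memLp_iff.2 hfX
  have hgL : ∀ k, MemLp (g ∘ ξ k) 2 P := fun k => (hidg k).memLp_iff.2 hgX
  have h1 := hC (fun k => f ∘ ξ k) (hind.comp _ fun _ => hf) hfL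
    (fun k ω => by
      simp only [f, g, Function.comp]
      linarith [le_max_left (ξ k ω - K) 0])
    (fun k => by rw [neg_neg, ← hfmean]; exact (hidf k).integral_eq.le)
    (fun k => ((hidf k).comp hsq).integral_eq.le) n
  have h2 := integral_sq_lindley_le (P := P) (ξ := fun k => g ∘ ξ k) (hind.comp _ fun _ => hg) hgL
    (fun k => ((hidg k).integral_eq.trans hgmean).le)
    (fun k => ((hidg k).comp hsq).integral_eq.le.trans hgsq) n
  have hξL : ∀ k, MemLp (ξ k) 2 P := fun k => (hid k).memLp_iff.2 hX
  have hIf := (memLp_lindley hfL n).integrable_sq.const_mul 2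
  have hIg := (memLp_lindley hgL n).integrable_sq.const_mul 2
  calc ∫ ω, lindley (fun k => ξ k ω) n ^ 2 ∂P
      ≤ ∫ ω, (2 * lindley (fun k => (f ∘ ξ k) ω) n ^ 2 +
          2 * lindley (fun k => (g ∘ ξ k) ω) n ^ 2) ∂P := by
        refine integral_mono (memLp_lindley hξL n).integrable_sq (hIf.add hIg) fun ω => ?_
        have hsum : (fun k => ξ k ω) = (fun k => (f ∘ ξ k) ω) + fun k => (g ∘ ξ k) ω := by
          ext k
          simp [f]
        have hle := lindley_add_le (fun k => (f ∘ ξ k) ω) (fun k => (g ∘ ξ k) ω) n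
        rw [← hsum] at hle
        have h0 := lindley_nonneg (fun k => ξ k ω) n
        simp only
        nlinarith [pow_le_pow_left₀ h0 hle 2, sq_nonneg (lindley (fun k => (f ∘ ξ k) ω) n -
          lindley (fun k => (g ∘ ξ k) ω) n)]
    _ ≤ 2 * C + ε * n := by
        rw [integral_add hIf hIg, integral_const_mul, integral_const_mul]
        linarith

end Probability

/-! ### Comparing the perimeter with twice the drift component of the endpoint -/

/-- The unit vectors `±e₀, ±e₁`. -/
noncomputable def axisDir : Fin 4 → Plane :=
  ![!₂[1, 0], !₂[-1, 0], !₂[0, 1], !₂[0, -1]]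

theorem norm_le_sum_axisDir (x : Plane) (r : ℝ) :
    ‖x‖ - 2 * r ≤ ∑ i, max 0 (inner ℝ x (axisDir i) - r) := by
  have hnorm : ‖x‖ ≤ |x 0| + |x 1| := by
    refine abs_le_of_sq_le_sq' ?_ (by positivity) |>.2
    rw [Plane.norm_sq_eq, ← sq_abs (x 0), ← sq_abs (x 1)]
    nlinarith [mul_nonneg (abs_nonneg (x 0)) (abs_nonneg (x 1))]
  have habs : ∀ a : ℝ, |a| - r ≤ max 0 (a - r) + max 0 (-a - r) := by
    intro a
    have h1 := le_max_left 0 (a - r)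
    have h2 := le_max_right 0 (a - r)
    have h3 := le_max_left 0 (-a - r)
    have h4 := le_max_right 0 (-a - r)
    rcases abs_cases a with ⟨h, -⟩ | ⟨h, -⟩ <;> rw [h] <;> linarith
  have h : ∑ i, max 0 (inner ℝ x (axisDir i) - r) =
      max 0 (x 0 - r) + max 0 (-x 0 - r) + max 0 (x 1 - r) + max 0 (-x 1 - r) := by
    simp [Fin.sum_univ_four, axisDir, Plane.inner_eq]
  rw [h]
  linarith [habs (x 0), habs (x 1)]

/-- A bound for `‖z k + ⋯ + z (n - 1)‖ - 2 (n - k) c`, uniform in `k ≤ n`, by Lindley recursions of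
the components of `z` along the coordinate axes. -/
noncomputable def driftExcess (z : ℕ → Plane) (c : ℝ) (n : ℕ) : ℝ :=
  ∑ i, lindley (fun j => inner ℝ (z j) (axisDir i) - c) n

theorem driftExcess_nonneg (z : ℕ → Plane) (c : ℝ) (n : ℕ) : 0 ≤ driftExcess z c n :=
  Finset.sum_nonneg fun _ _ => lindley_nonneg _ n

theorem norm_sum_Ico_sub_le (z : ℕ → Plane) (c : ℝ) {k n : ℕ} (h : k ≤ n) :
    ‖∑ j ∈ Finset.Ico k n, z j‖ - 2 * ((n - k : ℕ) * c) ≤ driftExcess z c n := by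
  refine (norm_le_sum_axisDir _ _).trans (Finset.sum_le_sum fun i _ => ?_)
  refine max_le (lindley_nonneg _ n) ((sum_Ico_le_lindley _ h).trans' (le_of_eq ?_))
  rw [sum_inner, Finset.sum_sub_distrib]
  simp

/-- The time reversal `k ↦ n - 1 - k` of `{0, …, n - 1}`, extended by the identity. -/
def reflect (n k : ℕ) : ℕ := if k < n then n - 1 - k else k

theorem reflect_injective (n : ℕ) : Function.Injective (reflect n) := by
  intro a b h
  unfold reflect at h
  split_ifs at h <;> omega

theorem norm_sum_range_sub_le (z : ℕ → Plane) (c : ℝ) {k n : ℕ} (h : k ≤ n) :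
    ‖∑ j ∈ Finset.range k, z j‖ - 2 * (k * c) ≤ driftExcess (fun j => z (reflect n j)) c n := by
  have hsum : ∑ j ∈ Finset.range k, z j = ∑ j ∈ Finset.Ico (n - k) n, z (reflect n j) := by
    refine Finset.sum_nbij' (fun j => n - 1 - j) (fun j => n - 1 - j) ?_ ?_ ?_ ?_ ?_ <;>
      intro j hj <;> simp only [Finset.mem_range, Finset.mem_Ico] at hj ⊢
    · omega
    · omega
    · omega
    · omega
    · rw [reflect, if_pos (by omega)]
      congr 1
      omega
  have := norm_sum_Ico_sub_le (fun j => z (reflect n j)) c (Nat.sub_le n k)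
  rwa [← hsum, Nat.sub_sub_self h] at this

theorem continuous_width (n : ℕ) (w : Plane) : Continuous fun p : (ℕ → Plane) × ℝ =>
    supportFn p.1 n (rotatedDir w p.2) + supportFn p.1 n (-rotatedDir w p.2) := by
  have hdir : Continuous fun p : (ℕ → Plane) × ℝ => rotatedDir w p.2 :=
    (continuous_rotatedDir w).comp continuous_snd
  have h₁ := (continuous_supportFn n).comp (continuous_fst.prodMk hdir)
  have h₂ := (continuous_supportFn n).comp (continuous_fst.prodMk hdir.neg)
  exact h₁.add h₂

section Deterministic

variable (y : ℕ → Plane) (μ : Plane) (n : ℕ)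

theorem supportFn_sub_inner_le {u : Plane} (hu : ‖u‖ = 1) {c : ℝ} (hc : 2 * c ≤ inner ℝ μ u) :
    supportFn (fun k => ∑ j ∈ Finset.range k, y j) n u - inner ℝ (∑ j ∈ Finset.range n, y j) u ≤
      driftExcess (fun j => y j - μ) c n := by
  rw [sub_le_iff_le_add]
  refine Finset.sup'_le _ _ fun k hk => ?_
  have hkn : k ≤ n := Nat.lt_succ_iff.1 (Finset.mem_range.1 hk)
  have h := norm_sum_Ico_sub_le (fun j => y j - μ) c hkn
  rw [← Finset.sum_range_add_sum_Ico y hkn, inner_add_left]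
  have hsum : ∑ j ∈ Finset.Ico k n, y j =
      ∑ j ∈ Finset.Ico k n, (y j - μ) + ((n - k : ℕ) : ℝ) • μ := by
    rw [Finset.sum_sub_distrib, Finset.sum_const, Nat.card_Ico, Nat.cast_smul_eq_nsmul]
    abel
  rw [hsum, inner_add_left, real_inner_smul_left]
  have hcs := (abs_le.1 (abs_real_inner_le_norm (∑ j ∈ Finset.Ico k n, (y j - μ)) u)).1
  rw [hu, mul_one] at hcs
  have := mul_le_mul_of_nonneg_left hc (Nat.cast_nonneg (α := ℝ) (n - k))
  linarith

theorem supportFn_neg_le {u : Plane} (hu : ‖u‖ = 1) {c : ℝ} (hc : 2 * c ≤ inner ℝ μ u) :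
    supportFn (fun k => ∑ j ∈ Finset.range k, y j) n (-u) ≤
      driftExcess (fun j => y (reflect n j) - μ) c n := by
  refine Finset.sup'_le _ _ fun k hk => ?_
  have hkn : k ≤ n := Nat.lt_succ_iff.1 (Finset.mem_range.1 hk)
  have h := norm_sum_range_sub_le (fun j => y j - μ) c hkn
  have hsum : ∑ j ∈ Finset.range k, y j = ∑ j ∈ Finset.range k, (y j - μ) + (k : ℝ) • μ := by
    rw [Finset.sum_sub_distrib, Finset.sum_const, Finset.card_range, Nat.cast_smul_eq_nsmul]
    abel
  change inner ℝ (∑ j ∈ Finset.range k, y j) (-u) ≤ _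
  rw [hsum, inner_neg_right, inner_add_left, real_inner_smul_left]
  have hcs := (abs_le.1 (abs_real_inner_le_norm (∑ j ∈ Finset.range k, (y j - μ)) u)).1
  rw [hu, mul_one] at hcs
  have := mul_le_mul_of_nonneg_left hc (Nat.cast_nonneg (α := ℝ) k)
  linarith

theorem inner_le_supportFn_add (u : Plane) :
    inner ℝ (∑ j ∈ Finset.range n, y j) u ≤
      supportFn (fun k => ∑ j ∈ Finset.range k, y j) n u +
        supportFn (fun k => ∑ j ∈ Finset.range k, y j) n (-u) := by
  have h1 : inner ℝ (∑ j ∈ Finset.range n, y j) u ≤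
      supportFn (fun k => ∑ j ∈ Finset.range k, y j) n u :=
    Finset.le_sup' (fun k => (inner ℝ (∑ j ∈ Finset.range k, y j) u : ℝ))
      (Finset.self_mem_range_succ n)
  have h2 : inner ℝ (∑ j ∈ Finset.range 0, y j) (-u) ≤
      supportFn (fun k => ∑ j ∈ Finset.range k, y j) n (-u) :=
    Finset.le_sup' (fun k => (inner ℝ (∑ j ∈ Finset.range k, y j) (-u) : ℝ))
      (Finset.mem_range.2 n.succ_pos)
  rw [Finset.sum_range_zero, inner_zero_left] at h2
  linarith

theorem norm_unitVec {μ : Plane} (hμ : μ ≠ 0) : ‖unitVec μ‖ = 1 := by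
  rw [unitVec, norm_smul, norm_inv, norm_norm, inv_mul_cancel₀ (norm_ne_zero_iff.2 hμ)]

theorem inner_rotatedDir_unitVec {μ : Plane} (hμ : μ ≠ 0) (θ : ℝ) :
    inner ℝ μ (rotatedDir (unitVec μ) θ) = ‖μ‖ * Real.cos θ := by
  have hcross : cross (unitVec μ) μ = 0 := by
    simp only [cross, unitVec, PiLp.smul_apply, smul_eq_mul]
    ring
  have := norm_ne_zero_iff.2 hμ
  rw [inner_rotatedDir, hcross, unitVec, real_inner_smul_right, real_inner_self_eq_norm_sq]
  field_simp
  ring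

theorem integral_le_of_le_of_le {g : ℝ → ℝ} (hg : Continuous g) {A B δ : ℝ} (hA : 0 ≤ A)
    (hδ : 0 ≤ δ) (hδ' : δ ≤ Real.pi / 2)
    (hgB : ∀ θ ∈ Set.Icc (-(Real.pi / 2)) (Real.pi / 2), g θ ≤ B)
    (hgA : ∀ θ ∈ Set.Icc (-(Real.pi / 2 - δ)) (Real.pi / 2 - δ), g θ ≤ A) :
    ∫ θ in (-(Real.pi / 2))..(Real.pi / 2), g θ ≤ Real.pi * A + 2 * δ * B := by
  have hint : ∀ a b, IntervalIntegrable g volume a b := fun a b => hg.intervalIntegrable a b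
  have hbound : ∀ {a b C : ℝ}, a ≤ b → (∀ θ ∈ Set.Icc a b, g θ ≤ C) →
      ∫ θ in a..b, g θ ≤ (b - a) * C := by
    intro a b C hab h
    have := intervalIntegral.integral_mono_on hab (hint a b) intervalIntegrable_const h
    rwa [intervalIntegral.integral_const, smul_eq_mul] at this
  rw [← intervalIntegral.integral_add_adjacent_intervals (hint _ (-(Real.pi / 2 - δ))) (hint _ _),
    ← intervalIntegral.integral_add_adjacent_intervals
      (hint (-(Real.pi / 2 - δ)) (Real.pi / 2 - δ)) (hint _ (Real.pi / 2))]
  have h1 := hbound (a := -(Real.pi / 2)) (b := -(Real.pi / 2 - δ)) (by linarith)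
    fun θ hθ => hgB θ ⟨hθ.1, by linarith [hθ.2]⟩
  have h2 := hbound (by linarith) hgA
  have h3 := hbound (a := Real.pi / 2 - δ) (b := Real.pi / 2) (by linarith)
    fun θ hθ => hgB θ ⟨by linarith [hθ.1], hθ.2⟩
  nlinarith [mul_nonneg hδ hA]

/-- Subtracting `2 ⟪Sₙ, μ / ‖μ‖⟫ = ∫ ⟪Sₙ, u θ⟫ dθ` from Cauchy's formula leaves an integrand that is
nonnegative, and small in the directions that make an angle of at least `δ` with the normal
directions of `μ`. -/
theorem perimeter_sub_inner_bounds {μ : Plane} (hμ : μ ≠ 0) {δ : ℝ} (hδ : 0 ≤ δ)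
    (hδ' : δ ≤ Real.pi / 2) :
    0 ≤ perimeter (convexHull ℝ ((fun k => ∑ j ∈ Finset.range k, y j) '' Set.Iic n)) -
        2 * inner ℝ (∑ j ∈ Finset.range n, y j) (unitVec μ) ∧
    perimeter (convexHull ℝ ((fun k => ∑ j ∈ Finset.range k, y j) '' Set.Iic n)) -
        2 * inner ℝ (∑ j ∈ Finset.range n, y j) (unitVec μ) ≤
      Real.pi * (driftExcess (fun j => y j - μ) (‖μ‖ * Real.sin δ / 2) n +
        driftExcess (fun j => y (reflect n j) - μ) (‖μ‖ * Real.sin δ / 2) n) +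
      2 * δ * (driftExcess (fun j => y j - μ) 0 n +
        driftExcess (fun j => y (reflect n j) - μ) 0 n) := by
  have hw := norm_unitVec hμ
  set w := unitVec μ with hwdef
  have hcont := continuous_rotatedDir w
  have hcw := (continuous_width n w).comp
    (Continuous.prodMk_right fun k => ∑ j ∈ Finset.range k, y j)
  simp only [Function.comp_def] at hcw
  have hci : Continuous fun θ => (inner ℝ (∑ j ∈ Finset.range n, y j) (rotatedDir w θ) : ℝ) := by
    fun_prop
  rw [perimeter_convexHull_eq_integral _ n hw, ← integral_inner_rotatedDir,
    ← intervalIntegral.integral_sub (hcw.intervalIntegrable _ _) (hci.intervalIntegrable _ _)]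
  have hbound : ∀ θ c, 2 * c ≤ inner ℝ μ (rotatedDir w θ) →
      supportFn (fun k => ∑ j ∈ Finset.range k, y j) n (rotatedDir w θ) +
        supportFn (fun k => ∑ j ∈ Finset.range k, y j) n (-rotatedDir w θ) -
        inner ℝ (∑ j ∈ Finset.range n, y j) (rotatedDir w θ) ≤
      driftExcess (fun j => y j - μ) c n + driftExcess (fun j => y (reflect n j) - μ) c n := by
    intro θ c hc
    linarith [supportFn_sub_inner_le y μ n (norm_rotatedDir hw θ) hc,
      supportFn_neg_le y μ n (norm_rotatedDir hw θ) hc]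
  constructor
  · exact intervalIntegral.integral_nonneg (by linarith [Real.pi_pos]) fun θ _ =>
      sub_nonneg.2 (inner_le_supportFn_add y n _)
  · refine integral_le_of_le_of_le (hcw.sub hci)
      (add_nonneg (driftExcess_nonneg _ _ _) (driftExcess_nonneg _ _ _)) hδ hδ'
      (fun θ hθ => hbound θ 0 ?_) (fun θ hθ => hbound θ _ ?_)
    · rw [inner_rotatedDir_unitVec hμ, mul_zero]
      exact mul_nonneg (norm_nonneg μ) (Real.cos_nonneg_of_mem_Icc hθ)
    · rw [inner_rotatedDir_unitVec hμ, mul_div_cancel₀ _ two_ne_zero]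
      refine mul_le_mul_of_nonneg_left ?_ (norm_nonneg μ)
      rw [← Real.cos_pi_div_two_sub, ← Real.cos_abs θ]
      exact Real.cos_le_cos_of_nonneg_of_le_pi (abs_nonneg θ) (by linarith [Real.pi_pos])
        (abs_le.2 hθ)

end Deterministic

/-! ### Second moments -/

section Probability

variable {Ω : Type*} [MeasurableSpace Ω] {P : Measure Ω}

theorem memLp_driftExcess [IsProbabilityMeasure P] {Y : ℕ → Ω → Plane}
    (hY : ∀ k, MemLp (Y k) 2 P) (μ : Plane) (c : ℝ) (n : ℕ) :
    MemLp (fun ω => driftExcess (fun j => Y j ω - μ) c n) 2 P :=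
  memLp_finsetSum _ fun i _ => memLp_lindley
    (fun k => (((hY k).sub (memLp_const μ)).inner_const (axisDir i)).sub (memLp_const c)) n

theorem integral_sq_driftExcess_le [IsProbabilityMeasure P] {Y : ℕ → Ω → Plane}
    (hY : ∀ k, MemLp (Y k) 2 P) (μ : Plane) (c : ℝ) (n : ℕ) :
    ∫ ω, driftExcess (fun j => Y j ω - μ) c n ^ 2 ∂P ≤
      4 * ∑ i, ∫ ω, lindley (fun j => inner ℝ (Y j ω - μ) (axisDir i) - c) n ^ 2 ∂P := by
  have hI : ∀ i, Integrable
      (fun ω => lindley (fun j => inner ℝ (Y j ω - μ) (axisDir i) - c) n ^ 2) P := fun i =>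
    (memLp_lindley (fun k =>
      (((hY k).sub (memLp_const μ)).inner_const (axisDir i)).sub (memLp_const c)) n).integrable_sq
  rw [← integral_finsetSum _ fun i _ => hI i, ← integral_const_mul]
  refine integral_mono (memLp_driftExcess hY μ c n).integrable_sq
    ((integrable_finsetSum _ fun i _ => hI i).const_mul 4) fun ω => ?_
  have := sq_sum_le_card_mul_sum_sq (s := Finset.univ)
    (f := fun i => lindley (fun j => inner ℝ (Y j ω - μ) (axisDir i) - c) n)
  simpa [driftExcess] using this

theorem integral_inner_sub_sub [IsProbabilityMeasure P] {X : Ω → Plane} (hX : MemLp X 2 P)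
    (v : Plane) (c : ℝ) : ∫ ω, (inner ℝ (X ω - ∫ ω, X ω ∂P) v - c) ∂P = -c := by
  have hI : Integrable (fun ω => X ω - ∫ ω, X ω ∂P) P :=
    (hX.integrable one_le_two).sub (integrable_const _)
  rw [integral_sub (hI.inner_const v) (integrable_const c)]
  simp only [real_inner_comm v]
  rw [integral_inner hI, integral_sub (hX.integrable one_le_two) (integrable_const _)]
  simp

theorem exists_integral_sq_driftExcess_zero_le [IsProbabilityMeasure P] {X : Ω → Plane}
    (hX : MemLp X 2 P) : ∃ C : ℝ, 0 ≤ C ∧ ∀ Y : ℕ → Ω → Plane, iIndepFun Y P →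
      (∀ k, IdentDistrib (Y k) X P P) →
      ∀ n : ℕ, ∫ ω, driftExcess (fun j => Y j ω - ∫ ω, X ω ∂P) 0 n ^ 2 ∂P ≤ C * n := by
  set μ := ∫ ω, X ω ∂P with hμ
  refine ⟨4 * ∑ i, ∫ ω, (inner ℝ (X ω - μ) (axisDir i) - 0) ^ 2 ∂P,
    mul_nonneg (by norm_num) (Finset.sum_nonneg fun i _ => integral_nonneg fun ω => sq_nonneg _),
    fun Y hind hid n => ?_⟩
  have hY : ∀ k, MemLp (Y k) 2 P := fun k => (hid k).memLp_iff.2 hX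
  refine (integral_sq_driftExcess_le hY μ 0 n).trans ?_
  rw [mul_assoc, Finset.sum_mul]
  refine mul_le_mul_of_nonneg_left (Finset.sum_le_sum fun i _ => ?_) (by norm_num)
  have hf : Measurable fun x : Plane => (inner ℝ (x - μ) (axisDir i) - 0 : ℝ) := by fun_prop
  have hidf := fun k => (hid k).comp hf
  rw [mul_comm]
  refine integral_sq_lindley_le (ξ := fun k ω => inner ℝ (Y k ω - μ) (axisDir i) - 0)
    (hind.comp _ fun _ => hf)
    (fun k => (((hY k).sub (memLp_const μ)).inner_const (axisDir i)).sub (memLp_const 0))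
    (fun k => ?_) (fun k => ?_) n
  · refine ((hidf k).integral_eq.trans (integral_inner_sub_sub hX (axisDir i) 0)).le.trans ?_
    simp
  · exact ((hidf k).comp (show Measurable fun x : ℝ => x ^ 2 by fun_prop)).integral_eq.le

theorem exists_integral_sq_driftExcess_le [IsProbabilityMeasure P] {X : Ω → Plane}
    (hX : MemLp X 2 P) {c ε : ℝ} (hc : 0 < c) (hε : 0 < ε) :
    ∃ C : ℝ, ∀ Y : ℕ → Ω → Plane, iIndepFun Y P → (∀ k, IdentDistrib (Y k) X P P) →
      ∀ n : ℕ, ∫ ω, driftExcess (fun j => Y j ω - ∫ ω, X ω ∂P) c n ^ 2 ∂P ≤ C + ε * n := by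
  set μ := ∫ ω, X ω ∂P with hμ
  have hL : ∀ i, MemLp (fun ω => (inner ℝ (X ω - μ) (axisDir i) - c : ℝ)) 2 P := fun i =>
    ((hX.sub (memLp_const μ)).inner_const (axisDir i)).sub (memLp_const c)
  choose C hC using fun i => exists_integral_sq_lindley_le_add_mul (hL i)
    (by rw [integral_inner_sub_sub hX]; exact neg_lt_zero.2 hc) (ε := ε / 16) (by positivity)
  refine ⟨4 * ∑ i, C i, fun Y hind hid n => ?_⟩
  have hY : ∀ k, MemLp (Y k) 2 P := fun k => (hid k).memLp_iff.2 hX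
  calc _ ≤ _ := integral_sq_driftExcess_le hY μ c n
    _ ≤ 4 * ∑ i, (C i + ε / 16 * n) := by
      refine mul_le_mul_of_nonneg_left (Finset.sum_le_sum fun i _ => ?_) (by norm_num)
      have hf : Measurable fun x : Plane => (inner ℝ (x - μ) (axisDir i) - c : ℝ) := by fun_prop
      exact hC i (fun k ω => inner ℝ (Y k ω - μ) (axisDir i) - c) (hind.comp _ fun _ => hf)
        (fun k => (hid k).comp hf) n
    _ = 4 * ∑ i, C i + ε * n := by
      rw [Finset.sum_add_distrib, Finset.sum_const, Finset.card_univ, Fintype.card_fin,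
        nsmul_eq_mul]
      push_cast
      ring

theorem aestronglyMeasurable_hullPerimeter {Z : ℕ → Ω → Plane} (hZ : ∀ k, AEMeasurable (Z k) P)
    (n : ℕ) : AEStronglyMeasurable (hullPerimeter Z n) P := by
  have hw : ‖(axisDir 0)‖ = 1 := by
    rw [← pow_eq_one_iff_of_nonneg (norm_nonneg _) two_ne_zero, Plane.norm_sq_eq]
    simp [axisDir]
  have hcont : Continuous fun x : ℕ → Plane =>
      ∫ θ in (-(Real.pi / 2))..(Real.pi / 2), (supportFn x n (rotatedDir (axisDir 0) θ) +
        supportFn x n (-rotatedDir (axisDir 0) θ)) :=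
    intervalIntegral.continuous_parametric_intervalIntegral_of_continuous
      (f := fun x θ => supportFn x n (rotatedDir (axisDir 0) θ) +
        supportFn x n (-rotatedDir (axisDir 0) θ))
      (μ := volume) (continuous_width n (axisDir 0)) continuous_const
  have hwalk : AEMeasurable (fun ω k => walk Z k ω) P :=
    aemeasurable_pi_lambda _ fun k => Finset.aemeasurable_fun_sum _ fun j _ => hZ j
  refine (hcont.measurable.comp_aemeasurable hwalk).aestronglyMeasurable.congr
    (ae_of_all _ fun ω => ?_)
  exact (perimeter_convexHull_eq_integral (fun k => walk Z k ω) n hw).symm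

variable [IsProbabilityMeasure P] {Z : ℕ → Ω → Plane}

theorem memLp_hullPerimeter_sub (hZ : ∀ k, MemLp (Z k) 2 P) {μ : Plane} (hμ : μ ≠ 0) (n : ℕ) :
    MemLp (fun ω => hullPerimeter Z n ω - 2 * inner ℝ (walk Z n ω) (unitVec μ)) 2 P := by
  have hwalk : MemLp (walk Z n) 2 P := memLp_finsetSum _ fun j _ => hZ j
  -- The bound of `perimeter_sub_inner_bounds` at `δ = 0` is a dominating function in `L²`.
  have hB : MemLp (fun ω => Real.pi * (driftExcess (fun j => Z j ω - μ) (‖μ‖ * Real.sin 0 / 2) n +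
      driftExcess (fun j => Z (reflect n j) ω - μ) (‖μ‖ * Real.sin 0 / 2) n) +
      2 * 0 * (driftExcess (fun j => Z j ω - μ) 0 n +
        driftExcess (fun j => Z (reflect n j) ω - μ) 0 n)) 2 P :=
    (((memLp_driftExcess hZ _ _ n).add
      (memLp_driftExcess (fun k => hZ (reflect n k)) _ _ n)).const_mul _).add
      (((memLp_driftExcess hZ _ _ n).add
      (memLp_driftExcess (fun k => hZ (reflect n k)) _ _ n)).const_mul _)
  refine hB.mono ((aestronglyMeasurable_hullPerimeter (fun k => (hZ k).aemeasurable) n).sub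
    ((hwalk.inner_const _).const_mul 2).1) (ae_of_all _ fun ω => ?_)
  have h := perimeter_sub_inner_bounds (fun j => Z j ω) n hμ le_rfl (by positivity)
  rw [Real.norm_eq_abs, Real.norm_eq_abs]
  exact abs_le_abs_of_nonneg h.1 h.2

theorem exists_integral_sq_hullPerimeter_sub_le (hind : iIndepFun Z P)
    (hid : ∀ k, IdentDistrib (Z k) (Z 0) P P) (hZ : MemLp (Z 0) 2 P)
    (hμ : ∫ ω, Z 0 ω ∂P ≠ 0) {η : ℝ} (hη : 0 < η) :
    ∃ C : ℝ, ∀ n : ℕ, ∫ ω, (hullPerimeter Z n ω -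
      2 * inner ℝ (walk Z n ω) (unitVec (∫ ω, Z 0 ω ∂P))) ^ 2 ∂P ≤ C + η * n := by
  have hZk : ∀ k, MemLp (Z k) 2 P := fun k => (hid k).memLp_iff.2 hZ
  obtain ⟨C₀, hC₀, hzero⟩ := exists_integral_sq_driftExcess_zero_le hZ
  -- The angle `δ` controls the nearly normal directions, where only the order `n` is available.
  obtain ⟨δ, hδ, hδ1, hδC⟩ : ∃ δ : ℝ, 0 < δ ∧ δ ≤ 1 ∧ 32 * δ ^ 2 * C₀ ≤ η / 2 := by
    refine ⟨min 1 (η / (64 * (C₀ + 1))), by positivity, min_le_left _ _, ?_⟩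
    set δ := min 1 (η / (64 * (C₀ + 1)))
    have h0 : 0 ≤ δ := by positivity
    have h1 : δ ≤ 1 := min_le_left _ _
    have h2 : δ * (64 * (C₀ + 1)) ≤ η := (le_div_iff₀ (by positivity)).1 (min_le_right _ _)
    nlinarith [mul_nonneg h0 (sub_nonneg.2 h1), mul_nonneg (mul_nonneg h0 (sub_nonneg.2 h1)) hC₀]
  have hδpi : δ ≤ Real.pi / 2 := by linarith [Real.pi_gt_three]
  set μ := ∫ ω, Z 0 ω ∂P with hμdef
  set c := ‖μ‖ * Real.sin δ / 2 with hcdef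
  have hc : 0 < c := by
    have h1 := norm_pos_iff.2 hμ
    have h2 := Real.sin_pos_of_pos_of_lt_pi hδ (by linarith [Real.pi_gt_three])
    positivity
  obtain ⟨C, hC⟩ := exists_integral_sq_driftExcess_le hZ hc
    (ε := η / (16 * Real.pi ^ 2)) (by positivity)
  refine ⟨8 * Real.pi ^ 2 * C, fun n => ?_⟩
  have hindr : iIndepFun (fun k => Z (reflect n k)) P := hind.precomp (reflect_injective n)
  have b1 := hC Z hind hid n
  have b2 := hC _ hindr (fun k => hid _) n
  have b3 := hzero Z hind hid n
  have b4 := hzero _ hindr (fun k => hid _) n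
  have i1 := (memLp_driftExcess hZk μ c n).integrable_sq
  have i2 := (memLp_driftExcess (fun k => hZk (reflect n k)) μ c n).integrable_sq
  have i3 := (memLp_driftExcess hZk μ 0 n).integrable_sq
  have i4 := (memLp_driftExcess (fun k => hZk (reflect n k)) μ 0 n).integrable_sq
  calc ∫ ω, (hullPerimeter Z n ω - 2 * inner ℝ (walk Z n ω) (unitVec μ)) ^ 2 ∂P
      ≤ ∫ ω, (4 * Real.pi ^ 2 * (driftExcess (fun j => Z j ω - μ) c n ^ 2 +
            driftExcess (fun j => Z (reflect n j) ω - μ) c n ^ 2) +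
          16 * δ ^ 2 * (driftExcess (fun j => Z j ω - μ) 0 n ^ 2 +
            driftExcess (fun j => Z (reflect n j) ω - μ) 0 n ^ 2)) ∂P := by
        refine integral_mono (memLp_hullPerimeter_sub hZk hμ n).integrable_sq
          (((i1.add i2).const_mul _).add ((i3.add i4).const_mul _)) fun ω => ?_
        have h := perimeter_sub_inner_bounds (fun j => Z j ω) n hμ hδ.le hδpi
        refine (pow_le_pow_left₀ h.1 h.2 2).trans ?_
        generalize driftExcess (fun j => Z j ω - μ) c n = p
        generalize driftExcess (fun j => Z (reflect n j) ω - μ) c n = q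
        generalize driftExcess (fun j => Z j ω - μ) 0 n = r
        generalize driftExcess (fun j => Z (reflect n j) ω - μ) 0 n = s
        nlinarith [sq_nonneg (Real.pi * (p + q) - 2 * δ * (r + s)),
          mul_nonneg (sq_nonneg Real.pi) (sq_nonneg (p - q)),
          mul_nonneg (sq_nonneg δ) (sq_nonneg (r - s))]
    _ = 4 * Real.pi ^ 2 * (∫ ω, driftExcess (fun j => Z j ω - μ) c n ^ 2 ∂P +
            ∫ ω, driftExcess (fun j => Z (reflect n j) ω - μ) c n ^ 2 ∂P) +
          16 * δ ^ 2 * (∫ ω, driftExcess (fun j => Z j ω - μ) 0 n ^ 2 ∂P +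
            ∫ ω, driftExcess (fun j => Z (reflect n j) ω - μ) 0 n ^ 2 ∂P) := by
        rw [← integral_add i1 i2, ← integral_add i3 i4, ← integral_const_mul,
          ← integral_const_mul]
        exact integral_add ((i1.add i2).const_mul _) ((i3.add i4).const_mul _)
    _ ≤ 4 * Real.pi ^ 2 * (2 * (C + η / (16 * Real.pi ^ 2) * n)) +
          16 * δ ^ 2 * (2 * (C₀ * n)) := by
        refine add_le_add (mul_le_mul_of_nonneg_left (by linarith) (by positivity))
          (mul_le_mul_of_nonneg_left (by linarith) (by positivity))
    _ = 8 * Real.pi ^ 2 * C + (η / 2) * n + 32 * δ ^ 2 * C₀ * n := by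
        field_simp
        ring
    _ ≤ 8 * Real.pi ^ 2 * C + (η / 2) * n + η / 2 * n := by
        gcongr
    _ = _ := by ring

end Probability

theorem mainTheorem8 {Ω : Type*} [MeasurableSpace Ω] (P : Measure Ω) [IsProbabilityMeasure P]
    (Z : ℕ → Ω → Plane)
    (hindep : iIndepFun Z P)
    (hident : ∀ k, IdentDistrib (Z k) (Z 0) P P)
    (hmoment : Integrable (fun ω => ‖Z 0 ω‖ ^ 2) P)
    (μ : Plane) (hμ : μ = ∫ ω, Z 0 ω ∂P) (hdrift : μ ≠ 0) :
    TendstoInLp P 2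
      (fun n ω => (n : ℝ) ^ (-(1 / 2) : ℝ) *
        |hullPerimeter Z n ω - 2 * inner ℝ (walk Z n ω) (unitVec μ)|)
      (fun _ => 0) := by
  subst hμ
  have hZ : MemLp (Z 0) 2 P :=
    (memLp_two_iff_integrable_sq_norm (hident 0).aemeasurable_fst.aestronglyMeasurable).2 hmoment
  have hZk : ∀ k, MemLp (Z k) 2 P := fun k => (hident k).memLp_iff.2 hZ
  have hL : ∀ n : ℕ, MemLp (fun ω => (n : ℝ) ^ (-(1 / 2) : ℝ) * |hullPerimeter Z n ω -
      2 * inner ℝ (walk Z n ω) (unitVec (∫ ω, Z 0 ω ∂P))|) 2 P := fun n =>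
    (memLp_hullPerimeter_sub hZk hdrift n).abs.const_mul _
  refine ⟨MemLp.zero, hL, ?_⟩
  have hsq : Tendsto (fun n : ℕ => ∫ ω, ((n : ℝ) ^ (-(1 / 2) : ℝ) * |hullPerimeter Z n ω -
      2 * inner ℝ (walk Z n ω) (unitVec (∫ ω, Z 0 ω ∂P))|) ^ 2 ∂P) atTop (𝓝 0) := by
    rw [Metric.tendsto_atTop]
    intro η hη
    obtain ⟨C, hC⟩ := exists_integral_sq_hullPerimeter_sub_le hindep hident hZ hdrift (half_pos hη)
    obtain ⟨N, hN⟩ := exists_nat_gt (C / (η / 2))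
    refine ⟨N + 1, fun n hn => ?_⟩
    have hn0 : (0 : ℝ) < n := Nat.cast_pos.2 (by omega)
    have hNn : (N : ℝ) ≤ n := Nat.cast_le.2 (by omega)
    have hCn : C < η / 2 * n := by
      rw [div_lt_iff₀ (by positivity)] at hN
      nlinarith
    rw [Real.dist_eq, sub_zero, abs_of_nonneg (integral_nonneg fun ω => sq_nonneg _)]
    have hpow : ((n : ℝ) ^ (-(1 / 2) : ℝ)) ^ 2 = (n : ℝ)⁻¹ := by
      rw [← Real.rpow_natCast, ← Real.rpow_mul hn0.le, ← Real.rpow_neg_one]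
      norm_num
    simp only [mul_pow, sq_abs, hpow]
    rw [integral_const_mul, inv_mul_lt_iff₀ hn0]
    linarith [hC n]
  have hroot := (ENNReal.continuous_ofReal.comp (Real.continuous_rpow_const
    (q := (2 : ENNReal).toReal⁻¹) (by simp))).continuousAt.tendsto.comp hsq
  simp only [Function.comp_def] at hroot
  rw [Real.zero_rpow (by simp), ENNReal.ofReal_zero] at hroot
  refine hroot.congr fun n => ?_
  have hsub : ((fun ω => (n : ℝ) ^ (-(1 / 2) : ℝ) * |hullPerimeter Z n ω -
      2 * inner ℝ (walk Z n ω) (unitVec (∫ ω, Z 0 ω ∂P))|) - fun _ => (0 : ℝ)) =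
      fun ω => (n : ℝ) ^ (-(1 / 2) : ℝ) * |hullPerimeter Z n ω -
      2 * inner ℝ (walk Z n ω) (unitVec (∫ ω, Z 0 ω ∂P))| := by
    ext ω
    simp
  rw [hsub, (hL n).eLpNorm_eq_integral_rpow_norm two_ne_zero ENNReal.ofNat_ne_top]
  simp only [Real.norm_eq_abs, ENNReal.toReal_ofNat, Real.rpow_ofNat, sq_abs]
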